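/- Let $Y\ge 0$ be a random variable with all moments finite, $m_k=\mathbf E[Y^k]<\infty$ for $k=1,2,\dots$, whose distribution $G$ is absolutely continuous with density $g$. Suppose that, for some $a>1$, $g$ is continuous and strictly positive on $[a,\infty)$, that $$\int_a^\infty \frac{-\ln g(x^2)}{x^2\ln x}\,dx=\infty,$$ and that the function $x\mapsto \dfrac{-\ln g(x)}{\ln x}$ is monotone increasing (in the weak sense) on $[a,\infty)$ and tends to $\infty$ as $x\to\infty$. Then $Y$ satisfies Carleman's condition in the Stieltjes case, $$\sum_{k=1}^\infty m_k^{-1/(2k)}=\infty,$$ and $Y$ is moment-determinate on $[0,\infty)$: $G$ is the only probability distribution on $[0,\infty)$ with moment sequence $(m_k)_{k\ge1}$. -/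

import Mathlib

open MeasureTheory ProbabilityTheory Filter Set
open scoped ENNReal

/-- All moments of the distribution `μ` on the real line are finite. -/
def HasFiniteMoments (μ : Measure ℝ) : Prop :=
  ∀ k : ℕ, Integrable (fun x : ℝ => |x| ^ k) μ

/-- Carleman's condition in the Stieltjes case: all moments `m_k` are finite and
`∑_{k ≥ 1} m_k ^ (-1 / (2 k)) = ∞`. The sum is taken in `[0, ∞]`, where `0 ^ (-1 / (2 k)) = ∞`;
the summation index `k` below stands for the moment of order `k + 1`. -/
def StieltjesCarleman (μ : Measure ℝ) : Prop :=
  HasFiniteMoments μ ∧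
    ∑' k : ℕ, ENNReal.ofReal (moment id (k + 1) μ) ^ (-(1 / (2 * ((k : ℝ) + 1)))) = ∞

/-- Moment-determinacy in the Stieltjes case: `μ` is a distribution on `[0, ∞)` with finite
moments, and it is the only probability distribution on `[0, ∞)` with its moments. -/
def StieltjesMDeterminate (μ : Measure ℝ) : Prop :=
  IsProbabilityMeasure μ ∧ μ (Iio 0) = 0 ∧ HasFiniteMoments μ ∧
    ∀ ν : Measure ℝ, IsProbabilityMeasure ν → ν (Iio 0) = 0 → HasFiniteMoments ν →
      (∀ k : ℕ, 1 ≤ k → moment id k ν = moment id k μ) → ν = μ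

/-! Write `g x = x ^ (-u x)` with `u` increasing to infinity, and let `x_k` be the point where `u`
crosses `k + 3`. Beyond `x_k` the integrand of the moment of order `k + 1` is at most `x⁻²`, so
`m_{k+1} ≤ x_k m_k + 1`. The moments being bounded below, `m_{k+1} ≤ R_k m_k` with `R_k` a constant
multiple of `x_k` (`exists_moment_ratio_bound`). Counting crossings, `u (x²) ≤ 3 + #{k | x_k ≤ x²}`;
integrated against `x⁻²`, this turns divergence of the logarithmic integral into `∑ 1/√R_k = ∞`.

Both conclusions follow from these monotone ratios. Since `m_{k+1} ≤ R_k ^ (k+1)`, Carleman's series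
dominates `∑ 1/√R_k`. For determinacy, each solution is symmetrized through `±√x`. The two
characteristic functions then have equal derivatives at `0`, and their `n`-th derivatives are
bounded by products of `√R_{⌊i/2⌋}`, so the Denjoy–Carleman theorem (`eq_zero_of_flat`, by Bang's
argument) makes them coincide. -/

/-! ### Flat functions in a quasi-analytic class -/

section Quasianalytic

variable {E : Type*} [NormedAddCommGroup E] [NormedSpace ℝ E] {F : ℕ → ℝ → E} {r : ℕ → ℝ}

/-- If the first `N` functions of a chain of derivatives are small at `s`, relative to
`∏ i < n, r i`, and the next one is small everywhere, then they stay small near `s`. -/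
lemma norm_le_mul_exp_of_hasDerivAt_chain (hF : ∀ n t, HasDerivAt (F n) (F (n + 1) t) t)
    (hr : ∀ n, 0 < r n) (hmono : Monotone r) {B s : ℝ} (hB : 0 ≤ B) (N : ℕ)
    (hs : ∀ n ≤ N, ‖F n s‖ ≤ B * (Real.exp n * ∏ i ∈ Finset.range n, r i))
    (htop : ∀ t, ‖F (N + 1) t‖ ≤ B * (Real.exp (N + 1 : ℕ) * ∏ i ∈ Finset.range (N + 1), r i))
    (n : ℕ) (hn : n ≤ N + 1) (x : ℝ) (hx : s ≤ x) :
    ‖F n x‖ ≤ B * (Real.exp n * ∏ i ∈ Finset.range n, r i) *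
      Real.exp (Real.exp 1 * r N * (x - s)) := by
  have hM : ∀ n : ℕ, 0 ≤ B * (Real.exp n * ∏ i ∈ Finset.range n, r i) := fun n =>
    mul_nonneg hB (mul_nonneg (Real.exp_pos _).le (Finset.prod_nonneg fun i _ => (hr i).le))
  induction hn using Nat.decreasingInduction generalizing x with
  | self =>
    refine (htop x).trans (le_mul_of_one_le_right (hM _) (Real.one_le_exp ?_))
    exact mul_nonneg (mul_pos (Real.exp_pos 1) (hr N)).le (sub_nonneg.2 hx)
  | of_succ k hk ih =>
    -- The majorant for `k` grows at rate `e * r N`, while the majorant for `k + 1` is `e * r k ≤ e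
    -- * r N` times it, so the bound on `F (k + 1)` integrates to that on `F k`.
    have hder : ∀ y, HasDerivAt (fun y => B * (Real.exp k * ∏ i ∈ Finset.range k, r i) *
        Real.exp (Real.exp 1 * r N * (y - s)))
        (B * (Real.exp k * ∏ i ∈ Finset.range k, r i) *
          (Real.exp (Real.exp 1 * r N * (y - s)) * (Real.exp 1 * r N * 1))) y := fun y =>
      ((((hasDerivAt_id y).sub_const s).const_mul (Real.exp 1 * r N)).exp).const_mul _
    refine image_norm_le_of_norm_deriv_right_le_deriv_boundary (a := s) (b := x)
      (fun y _ => (hF k y).continuousAt.continuousWithinAt)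
      (fun y _ => (hF k y).hasDerivWithinAt) ?_ hder ?_ (right_mem_Icc.2 hx)
    · simpa using hs k (by omega)
    · intro y hy
      refine (ih y hy.1).trans ?_
      rw [Finset.prod_range_succ, Nat.cast_succ, Real.exp_add]
      have h1 : r k ≤ r N := hmono (by omega)
      calc B * (Real.exp k * Real.exp 1 * ((∏ i ∈ Finset.range k, r i) * r k)) *
            Real.exp (Real.exp 1 * r N * (y - s))
          = B * (Real.exp k * ∏ i ∈ Finset.range k, r i) *
            Real.exp (Real.exp 1 * r N * (y - s)) * Real.exp 1 * r k := by ring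
        _ ≤ B * (Real.exp k * ∏ i ∈ Finset.range k, r i) *
            Real.exp (Real.exp 1 * r N * (y - s)) * Real.exp 1 * r N :=
          mul_le_mul_of_nonneg_left h1 (mul_nonneg (mul_nonneg (hM k) (Real.exp_pos _).le)
            (Real.exp_pos _).le)
        _ = _ := by ring

/-- Bang's argument: at `0` the bound holds for every `k`, and advancing by `1 / (e * r k)` costs
one factor `e`, which turns level `k + 1` into level `k`. Derivatives of order at least `k` need no
argument: there `exp (n - k) ≥ 1` and the global bound suffices. -/
lemma norm_le_exp_neg_of_le_sum (hF : ∀ n t, HasDerivAt (F n) (F (n + 1) t) t)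
    (hr : ∀ n, 0 < r n) (hmono : Monotone r) {C : ℝ} (hC : 0 ≤ C) (h0 : ∀ n, F n 0 = 0)
    (hbound : ∀ n t, ‖F n t‖ ≤ C * ∏ i ∈ Finset.range n, r i) (d k : ℕ) (x : ℝ) (hx0 : 0 ≤ x)
    (hx : x ≤ ∑ i ∈ Finset.range d, 1 / (Real.exp 1 * r (k + i))) (n : ℕ) :
    ‖F n x‖ ≤ C * Real.exp (-k) * (Real.exp n * ∏ i ∈ Finset.range n, r i) := by
  have hM : ∀ n, 0 ≤ ∏ i ∈ Finset.range n, r i := fun n => Finset.prod_nonneg fun i _ => (hr i).le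
  induction d generalizing k x n with
  | zero =>
    obtain rfl : x = 0 := le_antisymm (by simpa using hx) hx0
    rw [h0, norm_zero]
    exact mul_nonneg (mul_nonneg hC (Real.exp_pos _).le) (mul_nonneg (Real.exp_pos _).le (hM n))
  | succ d ih =>
    rcases le_or_gt n (k + 1) with hn | hn
    · set T := ∑ i ∈ Finset.range d, 1 / (Real.exp 1 * r (k + 1 + i)) with hT
      have hT0 : 0 ≤ T := Finset.sum_nonneg fun i _ =>
        (one_div_pos.2 (mul_pos (Real.exp_pos 1) (hr _))).le
      have hsum : x ≤ T + 1 / (Real.exp 1 * r k) := by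
        rw [Finset.sum_range_succ'] at hx
        simpa [hT, add_assoc, add_comm, add_left_comm] using hx
      have hB : 0 ≤ C * Real.exp (-(k + 1 : ℕ)) := mul_nonneg hC (Real.exp_pos _).le
      have hstep := norm_le_mul_exp_of_hasDerivAt_chain hF hr hmono hB k
        (fun m _ => ih (k + 1) (min x T) (le_min hx0 hT0) (min_le_right _ _) m)
        (fun t => by
          refine (hbound (k + 1) t).trans_eq ?_
          rw [mul_assoc, ← mul_assoc (Real.exp _), ← Real.exp_add]
          simp)
        n hn x (min_le_left _ _)
      refine hstep.trans ?_
      have hpos := mul_pos (Real.exp_pos 1) (hr k)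
      have hle : Real.exp 1 * r k * (x - min x T) ≤ 1 := by
        have : x - min x T ≤ 1 / (Real.exp 1 * r k) := by
          rcases le_total x T with h | h
          · rw [min_eq_left h, sub_self]; exact (one_div_pos.2 hpos).le
          · rw [min_eq_right h]; linarith
        calc _ ≤ Real.exp 1 * r k * (1 / (Real.exp 1 * r k)) :=
              mul_le_mul_of_nonneg_left this hpos.le
          _ = 1 := mul_one_div_cancel hpos.ne'
      refine (mul_le_mul_of_nonneg_left (Real.exp_le_exp.2 hle)
        (mul_nonneg hB (mul_nonneg (Real.exp_pos _).le (hM n)))).trans_eq ?_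
      have : Real.exp (-(k : ℝ)) = Real.exp (-(k + 1 : ℕ)) * Real.exp 1 := by
        rw [← Real.exp_add]; congr 1; push_cast; ring
      rw [this]; ring
    · refine (hbound n x).trans ?_
      rw [mul_assoc, ← mul_assoc (Real.exp _), ← Real.exp_add]
      refine mul_le_mul_of_nonneg_left (le_mul_of_one_le_left (hM n) (Real.one_le_exp ?_)) hC
      have : (k : ℝ) ≤ n := by exact_mod_cast (by omega : k ≤ n)
      linarith

lemma eq_zero_of_nonneg_of_flat (hF : ∀ n t, HasDerivAt (F n) (F (n + 1) t) t)
    (hr : ∀ n, 0 < r n) (hmono : Monotone r) (hdiv : ¬ Summable fun n => (r n)⁻¹)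
    {C : ℝ} (hC : 0 ≤ C) (h0 : ∀ n, F n 0 = 0)
    (hbound : ∀ n t, ‖F n t‖ ≤ C * ∏ i ∈ Finset.range n, r i) (x : ℝ) (hx0 : 0 ≤ x) :
    F 0 x = 0 := by
  have key : ∀ k : ℕ, ‖F 0 x‖ ≤ C * Real.exp (-k) := by
    intro k
    -- Divergence of the tail lets the steps starting at level `k` reach any `x`, whatever `k` is.
    have hdiv' : ¬ Summable fun i => 1 / (Real.exp 1 * r (k + i)) := by
      intro h
      apply hdiv
      rw [← summable_nat_add_iff k]
      refine (h.mul_left (Real.exp 1)).congr fun i => ?_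
      rw [add_comm k i, one_div, mul_inv, mul_inv_cancel_left₀ (Real.exp_pos 1).ne']
    have htend := (not_summable_iff_tendsto_nat_atTop_of_nonneg
      (fun i => (one_div_pos.2 (mul_pos (Real.exp_pos 1) (hr (k + i)))).le)).1 hdiv'
    obtain ⟨d, hd⟩ := (htend.eventually_ge_atTop x).exists
    simpa using norm_le_exp_neg_of_le_sum hF hr hmono hC h0 hbound d k x hx0 hd 0
  have hlim : Tendsto (fun k : ℕ => C * Real.exp (-k)) atTop (nhds (C * 0)) :=
    (Real.tendsto_exp_neg_atTop_nhds_zero.comp tendsto_natCast_atTop_atTop).const_mul C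
  rw [mul_zero] at hlim
  exact norm_le_zero_iff.1 (ge_of_tendsto' hlim key)

/-- **Denjoy–Carleman theorem**, sufficiency: a smooth function, flat at `0`, whose `n`-th
derivative is bounded by `C * ∏ i < n, r i` with `r` monotone and `∑ 1 / r n = ∞`, vanishes. -/
theorem eq_zero_of_flat (hF : ∀ n t, HasDerivAt (F n) (F (n + 1) t) t)
    (hr : ∀ n, 0 < r n) (hmono : Monotone r) (hdiv : ¬ Summable fun n => (r n)⁻¹)
    {C : ℝ} (hC : 0 ≤ C) (h0 : ∀ n, F n 0 = 0)
    (hbound : ∀ n t, ‖F n t‖ ≤ C * ∏ i ∈ Finset.range n, r i) (x : ℝ) :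
    F 0 x = 0 := by
  rcases le_total 0 x with hx | hx
  · exact eq_zero_of_nonneg_of_flat hF hr hmono hdiv hC h0 hbound x hx
  · have := eq_zero_of_nonneg_of_flat (F := fun n t => (-1 : ℝ) ^ n • F n (-t)) ?_ hr hmono hdiv hC
      (by simp [h0]) (fun n t => by simpa [norm_smul] using hbound n (-t)) (-x) (by linarith)
    · simpa using this
    · intro n t
      have := ((hF n (-t)).scomp t (hasDerivAt_neg t)).const_smul ((-1 : ℝ) ^ n)
      simpa [pow_succ, mul_smul, Function.comp_def, Pi.smul_def] using this

end Quasianalytic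

/-! ### Determinacy on the half line from a bound on the ratios of moments -/

lemma sqrt_pow_le_one_add_abs_pow (n : ℕ) (x : ℝ) : √x ^ n ≤ 1 + |x| ^ n := by
  rcases le_total x 1 with h | h
  · have : √x ≤ 1 := Real.sqrt_le_one.2 h
    have h2 : √x ^ n ≤ 1 := pow_le_one₀ (Real.sqrt_nonneg x) this
    have : 0 ≤ |x| ^ n := by positivity
    linarith
  · have h1 : √x ≤ |x| := (Real.sqrt_le_self_iff.2 (Or.inr h)).trans (le_abs_self x)
    have := pow_le_pow_left₀ (Real.sqrt_nonneg x) h1 n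
    linarith

lemma HasFiniteMoments.integrable_sqrt_pow {μ : Measure ℝ} [IsFiniteMeasure μ]
    (h : HasFiniteMoments μ) (n : ℕ) : Integrable (fun x => √x ^ n) μ := by
  refine ((integrable_const (1 : ℝ)).add (h n)).mono' (by fun_prop) (ae_of_all _ fun x => ?_)
  rw [Real.norm_of_nonneg (pow_nonneg (Real.sqrt_nonneg x) n)]
  exact sqrt_pow_le_one_add_abs_pow n x

lemma HasFiniteMoments.integrable_pow {μ : Measure ℝ}
    (h : HasFiniteMoments μ) (n : ℕ) : Integrable (fun x => x ^ n) μ :=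
  (h n).mono' (by fun_prop) (ae_of_all _ fun x => by simp)

lemma ae_nonneg_of_measure_Iio {μ : Measure ℝ} (h : μ (Iio 0) = 0) : ∀ᵐ x ∂μ, 0 ≤ x := by
  rw [ae_iff]; simpa [Iio_def] using h

/-- The symmetric measure of total mass `2 μ(ℝ)` whose image under squaring is `2 μ`, for `μ`
supported on `[0, ∞)`. -/
noncomputable def symmSqrt (μ : Measure ℝ) : Measure ℝ :=
  μ.map Real.sqrt + μ.map fun x => -√x

section symmSqrt

variable {μ : Measure ℝ}

instance [IsFiniteMeasure μ] : IsFiniteMeasure (symmSqrt μ) := by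
  unfold symmSqrt; infer_instance

lemma integrable_symmSqrt {f : ℝ → ℝ} (hf : Continuous f)
    (h1 : Integrable (fun x => f (√x)) μ) (h2 : Integrable (fun x => f (-√x)) μ) :
    Integrable f (symmSqrt μ) :=
  Integrable.add_measure
    ((integrable_map_measure hf.aestronglyMeasurable (by fun_prop)).2 h1)
    ((integrable_map_measure hf.aestronglyMeasurable (by fun_prop)).2 h2)

lemma integral_symmSqrt {f : ℝ → ℝ} (hf : Continuous f)
    (h1 : Integrable (fun x => f (√x)) μ) (h2 : Integrable (fun x => f (-√x)) μ) :
    ∫ y, f y ∂(symmSqrt μ) = ∫ x, f (√x) ∂μ + ∫ x, f (-√x) ∂μ := by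
  rw [symmSqrt, integral_add_measure
    ((integrable_map_measure hf.aestronglyMeasurable (by fun_prop)).2 h1)
    ((integrable_map_measure hf.aestronglyMeasurable (by fun_prop)).2 h2),
    integral_map (by fun_prop) hf.aestronglyMeasurable,
    integral_map (by fun_prop) hf.aestronglyMeasurable]

lemma map_sq_symmSqrt (h0 : μ (Iio 0) = 0) : (symmSqrt μ).map (fun y => y ^ 2) = μ + μ := by
  have h : (fun x => √x ^ 2) =ᵐ[μ] id := by
    filter_upwards [ae_nonneg_of_measure_Iio h0] with x hx using Real.sq_sqrt hx
  rw [symmSqrt, Measure.map_add _ _ (by fun_prop), Measure.map_map (by fun_prop) (by fun_prop),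
    Measure.map_map (by fun_prop) (by fun_prop)]
  simp only [Function.comp_def, neg_sq]
  rw [Measure.map_congr h, Measure.map_id]

variable [IsFiniteMeasure μ]

lemma HasFiniteMoments.integrable_abs_pow_symmSqrt (h : HasFiniteMoments μ) (n : ℕ) :
    Integrable (fun y => |y| ^ n) (symmSqrt μ) := by
  refine integrable_symmSqrt (by fun_prop) ?_ ?_ <;>
  simpa [abs_of_nonneg (Real.sqrt_nonneg _)] using h.integrable_sqrt_pow n

lemma HasFiniteMoments.integral_abs_pow_symmSqrt (h : HasFiniteMoments μ) (n : ℕ) :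
    ∫ y, |y| ^ n ∂(symmSqrt μ) = 2 * ∫ x, √x ^ n ∂μ := by
  have hi := h.integrable_sqrt_pow n
  rw [integral_symmSqrt (by fun_prop)] <;>
  simp only [abs_neg, abs_of_nonneg (Real.sqrt_nonneg _), hi]
  ring

lemma HasFiniteMoments.memLp_symmSqrt (h : HasFiniteMoments μ) (n : ℕ) :
    MemLp id n (symmSqrt μ) := by
  rcases Nat.eq_zero_or_pos n with rfl | hn
  · simpa using aestronglyMeasurable_id
  · rw [← integrable_norm_rpow_iff aestronglyMeasurable_id (by exact_mod_cast hn.ne') (by simp)]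
    simpa using h.integrable_abs_pow_symmSqrt n

lemma HasFiniteMoments.integral_pow_symmSqrt_even (h : HasFiniteMoments μ) (h0 : μ (Iio 0) = 0)
    (k : ℕ) : ∫ y, y ^ (2 * k) ∂(symmSqrt μ) = 2 * ∫ x, x ^ k ∂μ := by
  have := h.integral_abs_pow_symmSqrt (2 * k)
  simp only [pow_mul, sq_abs] at this ⊢
  rw [this]
  congr 1
  refine integral_congr_ae ?_
  filter_upwards [ae_nonneg_of_measure_Iio h0] with x hx
  rw [Real.sq_sqrt hx]

lemma HasFiniteMoments.integral_pow_symmSqrt_odd (h : HasFiniteMoments μ) {n : ℕ} (hn : Odd n) :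
    ∫ y, y ^ n ∂(symmSqrt μ) = 0 := by
  have hi := h.integrable_sqrt_pow n
  rw [integral_symmSqrt (f := fun y => y ^ n) (by fun_prop) hi]
  · simp only [hn.neg_pow]
    rw [integral_neg, add_neg_cancel]
  · simp only [hn.neg_pow]
    exact hi.neg

lemma norm_iteratedDeriv_charFun_symmSqrt_le (h : HasFiniteMoments μ) (n : ℕ) (t : ℝ) :
    ‖iteratedDeriv n (charFun (symmSqrt μ)) t‖ ≤ 2 * ∫ x, √x ^ n ∂μ := by
  rw [iteratedDeriv_charFun (h.memLp_symmSqrt n), norm_mul, norm_pow, Complex.norm_I, one_pow,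
    one_mul, ← h.integral_abs_pow_symmSqrt n]
  refine (norm_integral_le_integral_norm _).trans_eq (integral_congr_ae (ae_of_all _ fun y => ?_))
  have : ‖Complex.exp (t * y * Complex.I)‖ = 1 := by
    exact_mod_cast Complex.norm_exp_ofReal_mul_I (t * y)
  simp [this]

end symmSqrt

/-- If successive moments of a distribution on `[0, ∞)` satisfy `m (k + 1) ≤ R k * m k`, then its
moments of half-integer order satisfy the analogous bound with ratios `√(R (n / 2))`. -/
lemma integral_sqrt_pow_le_prod {μ : Measure ℝ} [IsProbabilityMeasure μ] (h0 : μ (Iio 0) = 0)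
    (hμ : HasFiniteMoments μ) {R : ℕ → ℝ} (hR : ∀ k, 0 < R k)
    (hm : ∀ k, ∫ x, x ^ (k + 1) ∂μ ≤ R k * ∫ x, x ^ k ∂μ) (n : ℕ) :
    ∫ x, √x ^ n ∂μ ≤ ∏ i ∈ Finset.range n, √(R (i / 2)) := by
  have hnn := ae_nonneg_of_measure_Iio h0
  have heven : ∀ k, ∫ x, √x ^ (2 * k) ∂μ = ∫ x, x ^ k ∂μ := fun k => by
    refine integral_congr_ae ?_
    filter_upwards [hnn] with x hx
    rw [pow_mul, Real.sq_sqrt hx]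
  have hodd : ∀ k, ∫ x, √x ^ (2 * k + 1) ∂μ ≤ √(R k) * ∫ x, √x ^ (2 * k) ∂μ := fun k => by
    have hs : 0 < √(R k) := Real.sqrt_pos.2 (hR k)
    have hi := (hμ.integrable_pow k).const_mul (√(R k) / 2)
    have hi' := (hμ.integrable_pow (k + 1)).const_mul (1 / (2 * √(R k)))
    calc ∫ x, √x ^ (2 * k + 1) ∂μ
        ≤ ∫ x, (√(R k) / 2 * x ^ k + 1 / (2 * √(R k)) * x ^ (k + 1)) ∂μ := by
          refine integral_mono_ae (hμ.integrable_sqrt_pow _) (hi.add hi') ?_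
          filter_upwards [hnn] with x hx
          have hk : 0 ≤ x ^ k := pow_nonneg hx k
          -- AM–GM, weighted so that after `m (k + 1) ≤ R k * m k` the two terms contribute equally.
          have h1 : √x ≤ √(R k) / 2 + 1 / (2 * √(R k)) * x := by
            nth_rewrite 2 [← Real.sq_sqrt hx]
            have h2 : √(R k) / 2 + 1 / (2 * √(R k)) * √x ^ 2 - √x
                = (√(R k) - √x) ^ 2 / (2 * √(R k)) := by field_simp; ring
            have h3 : 0 ≤ (√(R k) - √x) ^ 2 / (2 * √(R k)) := by positivity
            linarith
          rw [pow_succ, pow_mul, Real.sq_sqrt hx, pow_succ]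
          nlinarith [mul_le_mul_of_nonneg_left h1 hk]
      _ = √(R k) / 2 * ∫ x, x ^ k ∂μ + 1 / (2 * √(R k)) * ∫ x, x ^ (k + 1) ∂μ := by
          rw [integral_add hi hi', integral_const_mul, integral_const_mul]
      _ ≤ √(R k) / 2 * ∫ x, x ^ k ∂μ + 1 / (2 * √(R k)) * (R k * ∫ x, x ^ k ∂μ) := by
          gcongr; exact hm k
      _ = √(R k) * ∫ x, √x ^ (2 * k) ∂μ := by
          rw [heven]
          nth_rewrite 3 [← Real.sq_sqrt (hR k).le]
          field_simp; ring
  have hprod : ∀ k, ∫ x, √x ^ (2 * k) ∂μ ≤ ∏ i ∈ Finset.range (2 * k), √(R (i / 2)) := by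
    intro k
    induction k with
    | zero => simp
    | succ k ih =>
      -- The factors of index `2 * k` and `2 * k + 1` are both `√(R k)`, so together they supply one
      -- `R k`.
      rw [mul_add_one, Finset.prod_range_succ, Finset.prod_range_succ, mul_assoc,
        show (2 * k + 1) / 2 = k by omega, show 2 * k / 2 = k by omega,
        Real.mul_self_sqrt (hR k).le, ← mul_add_one, heven, mul_comm]
      rw [heven] at ih
      exact (hm k).trans (mul_le_mul_of_nonneg_left ih (hR k).le)
  obtain ⟨k, rfl | rfl⟩ := Nat.even_or_odd' n
  · exact hprod k
  · rw [Finset.prod_range_succ, show 2 * k / 2 = k by omega, mul_comm (Finset.prod _ _)]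
    exact (hodd k).trans (mul_le_mul_of_nonneg_left (hprod k) (Real.sqrt_nonneg _))

/-- Symmetrizing makes the odd moments vanish, so the unknown half-integer moments of `μ` and `ν`
enter only as bounds on derivatives. Squaring then recovers the measures. -/
theorem eq_of_moments_eq_of_ratio_le {μ ν : Measure ℝ} [IsProbabilityMeasure μ]
    [IsProbabilityMeasure ν] (hμ0 : μ (Iio 0) = 0) (hν0 : ν (Iio 0) = 0)
    (hμ : HasFiniteMoments μ) (hν : HasFiniteMoments ν)
    (hmom : ∀ k : ℕ, ∫ x, x ^ k ∂ν = ∫ x, x ^ k ∂μ)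
    {R : ℕ → ℝ} (hR : ∀ k, 0 < R k) (hmono : Monotone R)
    (hdiv : ¬ Summable fun k => (√(R k))⁻¹)
    (hm : ∀ k, ∫ x, x ^ (k + 1) ∂μ ≤ R k * ∫ x, x ^ k ∂μ) : ν = μ := by
  have hmν : ∀ k, ∫ x, x ^ (k + 1) ∂ν ≤ R k * ∫ x, x ^ k ∂ν := fun k => by
    rw [hmom, hmom]; exact hm k
  have hcd : ∀ {ρ : Measure ℝ} [IsFiniteMeasure ρ], HasFiniteMoments ρ → ∀ n t,
      HasDerivAt (iteratedDeriv n (charFun (symmSqrt ρ)))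
        (iteratedDeriv (n + 1) (charFun (symmSqrt ρ)) t) t := fun h n t => by
    have hc : ContDiff ℝ (n + 1 : ℕ) (charFun (symmSqrt _)) :=
      contDiff_charFun (h.memLp_symmSqrt (n + 1))
    have := hc.differentiable_iteratedDeriv n (by exact_mod_cast Nat.lt_succ_self n)
    rw [iteratedDeriv_succ]
    exact (this t).hasDerivAt
  have hzero : ∀ n, iteratedDeriv n (charFun (symmSqrt ν)) 0
      = iteratedDeriv n (charFun (symmSqrt μ)) 0 := fun n => by
    rw [iteratedDeriv_charFun_zero (hν.memLp_symmSqrt n),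
      iteratedDeriv_charFun_zero (hμ.memLp_symmSqrt n)]
    obtain ⟨k, rfl | rfl⟩ := Nat.even_or_odd' n
    · rw [hν.integral_pow_symmSqrt_even hν0, hμ.integral_pow_symmSqrt_even hμ0, hmom]
    · rw [hν.integral_pow_symmSqrt_odd (odd_two_mul_add_one k),
        hμ.integral_pow_symmSqrt_odd (odd_two_mul_add_one k)]
  -- Each symmetrized measure has mass `2`, whence `C = 4`. Even indices alone already make the
  -- series of reciprocals diverge.
  have hflat := eq_zero_of_flat (r := fun n => √(R (n / 2))) (C := 4)
    (F := fun n t => iteratedDeriv n (charFun (symmSqrt ν)) t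
      - iteratedDeriv n (charFun (symmSqrt μ)) t)
    (fun n t => (hcd hν n t).sub (hcd hμ n t)) (fun n => Real.sqrt_pos.2 (hR _))
    (fun m n h => Real.sqrt_le_sqrt (hmono (Nat.div_le_div_right h)))
    (fun h => hdiv (by
      have := h.comp_injective (i := fun k => 2 * k) (mul_right_injective₀ two_ne_zero)
      simpa [Function.comp_def] using this))
    (by norm_num) (fun n => sub_eq_zero.2 (hzero n))
    (fun n t => by
      have h1 := norm_iteratedDeriv_charFun_symmSqrt_le hν n t
      have h2 := norm_iteratedDeriv_charFun_symmSqrt_le hμ n t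
      have h3 := integral_sqrt_pow_le_prod hν0 hν hR hmν n
      have h4 := integral_sqrt_pow_le_prod hμ0 hμ hR hm n
      refine (norm_sub_le _ _).trans ?_
      linarith)
  have hσ : symmSqrt ν = symmSqrt μ :=
    Measure.ext_of_charFun (funext fun t => by simpa [sub_eq_zero] using hflat t)
  have hadd : ν + ν = μ + μ := by rw [← map_sq_symmSqrt hν0, ← map_sq_symmSqrt hμ0, hσ]
  ext s _
  have : ν s + ν s = μ s + μ s := by simpa using congrArg (fun ρ : Measure ℝ => ρ s) hadd
  rw [← two_mul, ← two_mul] at this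
  exact (ENNReal.mul_right_inj two_ne_zero ENNReal.ofNat_ne_top).1 this

/-! ### Carleman's condition from a bound on the ratios of moments -/

lemma integral_pow_le_pow_of_ratio_le {μ : Measure ℝ} [IsProbabilityMeasure μ] {R : ℕ → ℝ}
    (hR : ∀ k, 0 < R k) (hmono : Monotone R)
    (hm : ∀ k, ∫ x, x ^ (k + 1) ∂μ ≤ R k * ∫ x, x ^ k ∂μ) (k n : ℕ) (hn : n ≤ k + 1) :
    ∫ x, x ^ n ∂μ ≤ R k ^ n := by
  induction n with
  | zero => simp
  | succ n ih =>
    have hRn : R n ≤ R k := hmono (by omega)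
    rw [pow_succ' (R k)]
    calc ∫ x, x ^ (n + 1) ∂μ ≤ R n * ∫ x, x ^ n ∂μ := hm n
      _ ≤ R n * R k ^ n := mul_le_mul_of_nonneg_left (ih (by omega)) (hR n).le
      _ ≤ R k * R k ^ n := mul_le_mul_of_nonneg_right hRn (pow_nonneg (hR k).le n)

theorem stieltjesCarleman_of_ratio_le {μ : Measure ℝ} [IsProbabilityMeasure μ]
    (hμ : HasFiniteMoments μ) {R : ℕ → ℝ} (hR : ∀ k, 0 < R k) (hmono : Monotone R)
    (hdiv : ¬ Summable fun k => (√(R k))⁻¹)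
    (hm : ∀ k, ∫ x, x ^ (k + 1) ∂μ ≤ R k * ∫ x, x ^ k ∂μ) : StieltjesCarleman μ := by
  refine ⟨hμ, ?_⟩
  have hle : ∀ k : ℕ, ENNReal.ofReal (√(R k))⁻¹
      ≤ ENNReal.ofReal (moment id (k + 1) μ) ^ (-(1 / (2 * ((k : ℝ) + 1)))) := by
    intro k
    have hk : (0 : ℝ) < k + 1 := by positivity
    have h1 : moment id (k + 1) μ ≤ R k ^ (k + 1) := by
      simpa [moment] using integral_pow_le_pow_of_ratio_le hR hmono hm k (k + 1) le_rfl
    have h2 : (√(R k))⁻¹ = (R k ^ (k + 1)) ^ (-(1 / (2 * ((k : ℝ) + 1)))) := by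
      rw [← Real.rpow_natCast, ← Real.rpow_mul (hR k).le, Real.sqrt_eq_rpow,
        ← Real.rpow_neg (hR k).le]
      congr 1
      push_cast
      field_simp
    rw [h2, ← ENNReal.ofReal_rpow_of_pos (pow_pos (hR k) _), ENNReal.rpow_neg, ENNReal.rpow_neg]
    exact ENNReal.inv_le_inv.2 (ENNReal.rpow_le_rpow (ENNReal.ofReal_le_ofReal h1) (by positivity))
  by_contra hne
  refine hdiv ?_
  have := ENNReal.summable_toReal
    (ne_top_of_le_ne_top hne (ENNReal.tsum_le_tsum hle))
  exact this.congr fun k => ENNReal.toReal_ofReal (by positivity)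

/-! ### Densities with monotone logarithmic exponent -/

lemma integrableOn_Ioi_inv_sq {b : ℝ} (hb : 0 < b) :
    IntegrableOn (fun x : ℝ => (x ^ 2)⁻¹) (Ioi b) := by
  refine (integrableOn_Ioi_rpow_of_lt (by norm_num : (-2 : ℝ) < -1) hb).congr_fun
    (fun x hx => ?_) measurableSet_Ioi
  simp only
  rw [Real.rpow_neg (hb.trans hx).le]
  norm_num

lemma integral_Ioi_inv_sq {b : ℝ} (hb : 0 < b) : ∫ x in Ioi b, (x ^ 2)⁻¹ = b⁻¹ := by
  have h : ∫ x in Ioi b, (x ^ 2)⁻¹ = ∫ x in Ioi b, x ^ (-2 : ℝ) :=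
    setIntegral_congr_fun measurableSet_Ioi fun x hx => by
      rw [Real.rpow_neg (hb.trans hx).le]
      norm_num
  rw [h, integral_Ioi_rpow_of_lt (by norm_num) hb]
  norm_num [Real.rpow_neg_one]

lemma lintegral_Ioi_inv_sq {b : ℝ} (hb : 0 < b) :
    ∫⁻ x in Ioi b, ENNReal.ofReal (x ^ 2)⁻¹ = ENNReal.ofReal b⁻¹ := by
  rw [← integral_Ioi_inv_sq hb, ofReal_integral_eq_lintegral_ofReal (integrableOn_Ioi_inv_sq hb)
    (ae_of_all _ fun x => by positivity)]

/-- The point from which on the function `u`, increasing on `[a, ∞)`, exceeds `k + 3`. -/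
noncomputable def crossing (u : ℝ → ℝ) (a : ℝ) (k : ℕ) : ℝ :=
  sInf {x | a ≤ x ∧ (k : ℝ) + 3 ≤ u x}

section crossing

variable {u : ℝ → ℝ} {a : ℝ}

lemma crossing_le {k : ℕ} {x : ℝ} (hx : a ≤ x) (hux : (k : ℝ) + 3 ≤ u x) : crossing u a k ≤ x :=
  csInf_le ⟨a, fun _ h => h.1⟩ ⟨hx, hux⟩

lemma nonempty_crossing_set (hu : Tendsto u atTop atTop) (k : ℕ) :
    {x | a ≤ x ∧ (k : ℝ) + 3 ≤ u x}.Nonempty :=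
  ((eventually_ge_atTop a).and (hu.eventually_ge_atTop _)).exists

lemma le_crossing (hu : Tendsto u atTop atTop) (k : ℕ) : a ≤ crossing u a k :=
  le_csInf (nonempty_crossing_set hu k) fun _ h => h.1

lemma monotone_crossing (hu : Tendsto u atTop atTop) : Monotone (crossing u a) := fun j k hjk =>
  csInf_le_csInf ⟨a, fun _ h => h.1⟩ (nonempty_crossing_set hu k) fun x hx =>
    ⟨hx.1, le_trans (by gcongr) hx.2⟩

lemma le_of_crossing_lt (hu : Tendsto u atTop atTop) (hmono : MonotoneOn u (Ici a)) {k : ℕ} {x : ℝ}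
    (hx : crossing u a k < x) : (k : ℝ) + 3 ≤ u x := by
  obtain ⟨y, hy, hyx⟩ := exists_lt_of_csInf_lt (nonempty_crossing_set hu k) hx
  exact hy.2.trans (hmono hy.1 (hy.1.trans hyx.le) hyx.le)

/-- Every `k < u (x²) - 3` has its crossing at or before `x²`, so at least `⌈u (x²) - 3⌉₊`
indicators equal `2 / x²`; the remaining `3` gives the term `6 / x²`. -/
lemma ofReal_mul_inv_sq_le_tsum_crossing (ha : 1 < a) {x : ℝ} (hx : a < x) :
    ENNReal.ofReal (2 * u (x ^ 2) * (x ^ 2)⁻¹) ≤ 6 * ENNReal.ofReal (x ^ 2)⁻¹ +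
      ∑' k, (Ici √(crossing u a k)).indicator (fun x => 2 * ENNReal.ofReal (x ^ 2)⁻¹) x := by
  have hx0 : 0 < x := by linarith
  have hax : a ≤ x ^ 2 := by nlinarith
  set q := (x ^ 2)⁻¹ with hq
  have hq0 : 0 ≤ q := by positivity
  set v := u (x ^ 2) with hv
  set N := ⌈v - 3⌉₊ with hN
  have hcount : (N : ℝ≥0∞) * (2 * ENNReal.ofReal q) ≤
      ∑' k, (Ici √(crossing u a k)).indicator (fun x => 2 * ENNReal.ofReal (x ^ 2)⁻¹) x := by
    refine le_trans (le_of_eq ?_) (ENNReal.sum_le_tsum (Finset.range N))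
    rw [Finset.sum_congr rfl (g := fun _ => 2 * ENNReal.ofReal q), Finset.sum_const,
      Finset.card_range, nsmul_eq_mul]
    intro k hk
    have hk' : (k : ℝ) < v - 3 := Nat.lt_ceil.1 (Finset.mem_range.1 hk)
    exact indicator_of_mem
      (mem_Ici.2 ((Real.sqrt_le_left hx0.le).2 (crossing_le hax (by linarith)))) _
  refine le_trans ?_ (add_le_add_right hcount _)
  have hvN : v ≤ N + 3 := by linarith [Nat.le_ceil (v - 3)]
  calc ENNReal.ofReal (2 * v * q) ≤ ENNReal.ofReal (6 * q + N * (2 * q)) :=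
        ENNReal.ofReal_le_ofReal (by nlinarith)
    _ = _ := by
      rw [ENNReal.ofReal_add (by positivity) (by positivity), ENNReal.ofReal_mul (by norm_num),
        ENNReal.ofReal_mul (by positivity), ENNReal.ofReal_mul (by norm_num)]
      simp

/-- If `∫ u(x²) / x² dx` diverges at infinity, then so does the sum of `1 / √x_k`, where `x_k` are
the successive crossing points of `u`. -/
lemma not_summable_inv_sqrt_crossing (ha : 1 < a) (hu : Tendsto u atTop atTop)
    (hK : Tendsto (fun R : ℝ => ∫ x in a..R, 2 * u (x ^ 2) * (x ^ 2)⁻¹) atTop atTop) :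
    ¬ Summable fun k => (√(crossing u a k))⁻¹ := by
  intro hsum
  have ha0 : 0 < a := by linarith
  have hc0 : ∀ k, 0 < √(crossing u a k) := fun k =>
    Real.sqrt_pos.2 (ha0.trans_le (le_crossing hu k))
  have hfin : ∫⁻ x in Ioi a, ENNReal.ofReal (2 * u (x ^ 2) * (x ^ 2)⁻¹) ≠ ∞ := by
    refine ne_top_of_le_ne_top (b := 6 * ENNReal.ofReal a⁻¹ +
      ∑' k, 2 * ENNReal.ofReal (√(crossing u a k))⁻¹) ?_ ?_
    · rw [ENNReal.tsum_mul_left]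
      refine ENNReal.add_ne_top.2 ⟨ENNReal.mul_ne_top (by simp) (by simp),
        ENNReal.mul_ne_top (by simp) hsum.tsum_ofReal_ne_top⟩
    · refine (setLIntegral_mono' measurableSet_Ioi
        fun x hx => ofReal_mul_inv_sq_le_tsum_crossing ha hx).trans ?_
      rw [lintegral_add_left (by fun_prop), lintegral_const_mul _ (by fun_prop),
        lintegral_Ioi_inv_sq ha0, lintegral_tsum (fun k =>
          (Measurable.indicator (by fun_prop) measurableSet_Ici).aemeasurable)]
      refine add_le_add_right (ENNReal.tsum_le_tsum fun k => ?_) _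
      refine (setLIntegral_le_lintegral _ _).trans ?_
      rw [lintegral_indicator measurableSet_Ici, ← restrict_Ioi_eq_restrict_Ici,
        lintegral_const_mul _ (by fun_prop), lintegral_Ioi_inv_sq (hc0 k)]
  obtain ⟨R, hR, haR⟩ := ((hK.eventually_gt_atTop
    (∫⁻ x in Ioi a, ENNReal.ofReal (2 * u (x ^ 2) * (x ^ 2)⁻¹)).toReal).and
    (eventually_ge_atTop a)).exists
  refine hR.not_ge ?_
  rw [intervalIntegral.integral_of_le haR]
  -- If integrability fails, the Bochner integral is `0` by convention and the bound is trivial.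
  by_cases hint : Integrable (fun x => 2 * u (x ^ 2) * (x ^ 2)⁻¹) (volume.restrict (Ioc a R))
  · rw [integral_eq_lintegral_pos_part_sub_lintegral_neg_part hint]
    refine (sub_le_self _ ENNReal.toReal_nonneg).trans (ENNReal.toReal_mono hfin ?_)
    exact lintegral_mono_set Ioc_subset_Ioi_self
  · rw [integral_undef hint]
    exact ENNReal.toReal_nonneg

end crossing

section density

variable {g : ℝ → ℝ} {a : ℝ}

/-- The offset `3` is `1 + 2`: an exponent `k + 1` cancels the power, and `2` more leave an
integrable tail. -/
lemma pow_mul_le_inv_sq_of_exponent_ge {x : ℝ} (hx : 1 < x) (hgx : 0 < g x) {k : ℕ}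
    (h : (k : ℝ) + 3 ≤ -Real.log (g x) / Real.log x) : g x * x ^ (k + 1) ≤ (x ^ 2)⁻¹ := by
  have hlog := Real.log_pos hx
  have hx0 : 0 < x := by linarith
  rw [le_div_iff₀ hlog] at h
  have h1 : Real.log (g x * x ^ (k + 1)) ≤ Real.log (x ^ 2)⁻¹ := by
    rw [Real.log_mul hgx.ne' (by positivity), Real.log_pow, Real.log_inv, Real.log_pow]
    push_cast
    linarith
  exact (Real.log_le_log_iff (by positivity) (by positivity)).1 h1

lemma setIntegral_Ioi_crossing_le {μ : Measure ℝ} (hg_meas : Measurable g)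
    (hg_nonneg : ∀ x, 0 ≤ g x)
    (hμ : μ = volume.withDensity (fun x => ENNReal.ofReal (g x)))
    (ha : 1 < a) (hg_pos : ∀ x ∈ Ici a, 0 < g x)
    (hu_mono : MonotoneOn (fun x : ℝ => -Real.log (g x) / Real.log x) (Ici a))
    (hu_lim : Tendsto (fun x : ℝ => -Real.log (g x) / Real.log x) atTop atTop) (k : ℕ) :
    ∫ x in Ioi (crossing (fun x : ℝ => -Real.log (g x) / Real.log x) a k), x ^ (k + 1) ∂μ ≤ 1 := by
  set c := crossing (fun x : ℝ => -Real.log (g x) / Real.log x) a k with hc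
  have hac : a ≤ c := le_crossing hu_lim k
  have hc0 : 0 < c := by linarith
  rw [hμ, restrict_withDensity measurableSet_Ioi, integral_withDensity_eq_integral_toReal_smul
    (by fun_prop) (ae_of_all _ fun x => ENNReal.ofReal_lt_top)]
  calc ∫ x in Ioi c, (ENNReal.ofReal (g x)).toReal • x ^ (k + 1)
      ≤ ∫ x in Ioi c, (x ^ 2)⁻¹ := by
        refine integral_mono_of_nonneg ?_ (integrableOn_Ioi_inv_sq hc0) ?_
        · refine (ae_restrict_iff' measurableSet_Ioi).2 (ae_of_all _ fun x hx => ?_)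
          exact smul_nonneg ENNReal.toReal_nonneg (pow_nonneg (hc0.trans hx).le _)
        · refine (ae_restrict_iff' measurableSet_Ioi).2 (ae_of_all _ fun x hx => ?_)
          have hax : a < x := hac.trans_lt hx
          simp only [ENNReal.toReal_ofReal (hg_nonneg x), smul_eq_mul]
          exact pow_mul_le_inv_sq_of_exponent_ge (ha.trans hax) (hg_pos x hax.le)
            (le_of_crossing_lt hu_lim hu_mono hx)
    _ = c⁻¹ := integral_Ioi_inv_sq hc0
    _ ≤ 1 := inv_le_one_of_one_le₀ (by linarith)

lemma measureReal_Ici_pos {μ : Measure ℝ} [IsFiniteMeasure μ] (hg_meas : Measurable g)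
    (hμ : μ = volume.withDensity (fun x => ENNReal.ofReal (g x)))
    (hg_pos : ∀ x ∈ Ici a, 0 < g x) : 0 < μ.real (Ici a) := by
  refine ENNReal.toReal_pos (fun h => ?_) (measure_ne_top _ _)
  rw [hμ, withDensity_apply _ measurableSet_Ici, lintegral_eq_zero_iff (by fun_prop)] at h
  have h2 : ∀ᵐ x ∂(volume.restrict (Ici a)), False := by
    filter_upwards [h, ae_restrict_mem measurableSet_Ici] with x hx hxa
    exact (hg_pos x hxa).not_ge (ENNReal.ofReal_eq_zero.1 hx)
  rw [ae_iff] at h2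
  simp at h2

/-- A lower bound on the moments uniform in `k`, needed to absorb the additive tail error. -/
lemma measureReal_Ici_le_integral_pow {μ : Measure ℝ} [IsFiniteMeasure μ] (ha : 1 < a)
    (h0 : μ (Iio 0) = 0) (hμ : HasFiniteMoments μ) (k : ℕ) :
    μ.real (Ici a) ≤ ∫ x, x ^ k ∂μ := by
  rw [← integral_indicator_one measurableSet_Ici]
  refine integral_mono_ae ((integrable_const (1 : ℝ)).indicator measurableSet_Ici)
    (hμ.integrable_pow k) ?_
  filter_upwards [ae_nonneg_of_measure_Iio h0] with x hx
  by_cases hxa : x ∈ Ici a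
  · rw [indicator_of_mem hxa]
    exact one_le_pow₀ (ha.le.trans hxa)
  · rw [indicator_of_notMem hxa]
    positivity

lemma integral_pow_succ_le {μ : Measure ℝ} {c : ℝ} (hc : 0 ≤ c) (h0 : μ (Iio 0) = 0)
    (hμ : HasFiniteMoments μ) (k : ℕ) :
    ∫ x, x ^ (k + 1) ∂μ ≤ c * ∫ x, x ^ k ∂μ + ∫ x in Ioi c, x ^ (k + 1) ∂μ := by
  have h1 := (hμ.integrable_pow k).const_mul c
  have h2 := (hμ.integrable_pow (k + 1)).indicator (measurableSet_Ioi (a := c))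
  rw [← integral_const_mul, ← integral_indicator measurableSet_Ioi, ← integral_add h1 h2]
  refine integral_mono_ae (hμ.integrable_pow _) (h1.add h2) ?_
  filter_upwards [ae_nonneg_of_measure_Iio h0] with x hx
  by_cases hxc : x ∈ Ioi c
  · rw [indicator_of_mem hxc]
    have : 0 ≤ c * x ^ k := by positivity
    linarith
  · rw [indicator_of_notMem hxc, add_zero, pow_succ']
    exact mul_le_mul_of_nonneg_right (not_lt.1 hxc) (by positivity)

/-- The successive moments of a distribution on `[0, ∞)` whose density has an increasing
logarithmic exponent satisfy `m (k + 1) ≤ R k * m k` for a monotone `R` with `∑ 1 / √(R k) = ∞`,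
provided that the logarithmic integral of the density diverges. -/
theorem exists_moment_ratio_bound {μ : Measure ℝ} [IsProbabilityMeasure μ] (h0 : μ (Iio 0) = 0)
    (hμm : HasFiniteMoments μ) (hg_meas : Measurable g) (hg_nonneg : ∀ x, 0 ≤ g x)
    (hμ : μ = volume.withDensity (fun x => ENNReal.ofReal (g x)))
    (ha : 1 < a) (hg_pos : ∀ x ∈ Ici a, 0 < g x)
    (hK : Tendsto (fun R : ℝ => ∫ x in a..R, -Real.log (g (x ^ 2)) / (x ^ 2 * Real.log x))
      atTop atTop)
    (hu_mono : MonotoneOn (fun x : ℝ => -Real.log (g x) / Real.log x) (Ici a))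
    (hu_lim : Tendsto (fun x : ℝ => -Real.log (g x) / Real.log x) atTop atTop) :
    ∃ R : ℕ → ℝ, (∀ k, 0 < R k) ∧ Monotone R ∧ (¬ Summable fun k => (√(R k))⁻¹) ∧
      ∀ k, ∫ x, x ^ (k + 1) ∂μ ≤ R k * ∫ x, x ^ k ∂μ := by
  set u : ℝ → ℝ := fun x => -Real.log (g x) / Real.log x with hu
  have hp := measureReal_Ici_pos hg_meas hμ hg_pos
  set p := μ.real (Ici a) with hp_def
  have hC : 0 < 1 + p⁻¹ := by positivity
  have hac : ∀ k, a ≤ crossing u a k := le_crossing hu_lim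
  have hK' : Tendsto (fun R : ℝ => ∫ x in a..R, 2 * u (x ^ 2) * (x ^ 2)⁻¹) atTop atTop := by
    -- The factor `2` comes from `log (x²) = 2 log x`.
    refine hK.congr fun R => intervalIntegral.integral_congr fun x _ => ?_
    simp only [hu, Real.log_pow]
    push_cast
    ring
  -- The tail contributes at most `1 ≤ p⁻¹ * x_k * m_k`, because `m_k ≥ p` and `x_k ≥ 1`; hence the
  -- constant `1 + p⁻¹`.
  refine ⟨fun k => (1 + p⁻¹) * crossing u a k, fun k => mul_pos hC (by linarith [hac k]),
    fun j k h => mul_le_mul_of_nonneg_left (monotone_crossing hu_lim h) hC.le, fun hs => ?_,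
    fun k => ?_⟩
  · refine not_summable_inv_sqrt_crossing ha hu_lim hK'
      ((hs.mul_left √(1 + p⁻¹)).congr fun k => ?_)
    rw [Real.sqrt_mul hC.le, mul_inv, mul_inv_cancel_left₀ (Real.sqrt_pos.2 hC).ne']
  · have h1 := integral_pow_succ_le (c := crossing u a k) (by linarith [hac k]) h0 hμm k
    have h2 := setIntegral_Ioi_crossing_le hg_meas hg_nonneg hμ ha hg_pos hu_mono hu_lim k
    have h3 := measureReal_Ici_le_integral_pow ha h0 hμm k
    have hc1 : 1 ≤ crossing u a k := ha.le.trans (hac k)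
    have h4 : 1 ≤ p⁻¹ * crossing u a k * ∫ x, x ^ k ∂μ := by
      calc 1 = p⁻¹ * 1 * p := by field_simp
        _ ≤ _ := mul_le_mul (mul_le_mul_of_nonneg_left hc1 (by positivity)) h3 hp.le
            (by positivity)
    linarith

end density

theorem theorem2 {Ω : Type*} [MeasurableSpace Ω] (P : Measure Ω) [IsProbabilityMeasure P]
    (Y : Ω → ℝ) (hY : AEMeasurable Y P) (hY_nonneg : ∀ᵐ ω ∂P, 0 ≤ Y ω)
    (hY_moments : HasFiniteMoments (P.map Y))
    (g : ℝ → ℝ) (hg_meas : Measurable g) (hg_nonneg : ∀ x, 0 ≤ g x)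
    (hg_density : P.map Y = volume.withDensity (fun x => ENNReal.ofReal (g x)))
    (a : ℝ) (ha : 1 < a)
    (hg_cont : ContinuousOn g (Ici a)) (hg_pos : ∀ x ∈ Ici a, 0 < g x)
    (hK : Tendsto (fun R : ℝ => ∫ x in a..R, -Real.log (g (x ^ 2)) / (x ^ 2 * Real.log x))
      atTop atTop)
    (hu_mono : MonotoneOn (fun x : ℝ => -Real.log (g x) / Real.log x) (Ici a))
    (hu_lim : Tendsto (fun x : ℝ => -Real.log (g x) / Real.log x) atTop atTop) :
    StieltjesCarleman (P.map Y) ∧ StieltjesMDeterminate (P.map Y) := by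
  have hprob : IsProbabilityMeasure (P.map Y) := Measure.isProbabilityMeasure_map hY
  have h0 : (P.map Y) (Iio 0) = 0 := by
    rw [Measure.map_apply_of_aemeasurable hY measurableSet_Iio]
    refine measure_mono_null (fun ω hω => ?_) (ae_iff.1 hY_nonneg)
    exact not_le.2 hω
  obtain ⟨R, hR, hmono, hdiv, hm⟩ := exists_moment_ratio_bound h0 hY_moments hg_meas hg_nonneg
    hg_density ha hg_pos hK hu_mono hu_lim
  refine ⟨stieltjesCarleman_of_ratio_le hY_moments hR hmono hdiv hm, hprob, h0, hY_moments,
    fun ν hν hν0 hνm hmom => ?_⟩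
  refine eq_of_moments_eq_of_ratio_le h0 hν0 hY_moments hνm (fun k => ?_) hR hmono hdiv hm
  -- Order `0` is not among the assumed equalities; both measures have mass `1`.
  rcases Nat.eq_zero_or_pos k with rfl | hk
  · simp
  · simpa [moment] using hmom k hk
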